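/- Let $\Omega\subset\mathbb{R}^d$ be a bounded connected open set. At a point $x\in\partial\Omega$ near which $\Omega$ is the sublevel set $\{\psi<0\}$ of a $C^1$ function $\psi$ without critical points, let $\mathbf n(x)=\nabla\psi(x)/|\nabla\psi(x)|$ be the outward unit normal; all conditions and claims below that involve $\mathbf n$ or tangent vectors $\boldsymbol\tau$ are meant at all such points $x$ (for a domain with $C^1$ boundary: at all points of $\partial\Omega$). We write $C^m(\overline\Omega)$ for the functions that are continuous on $\overline\Omega$ and $C^m$ in $\Omega$ and all of whose derivatives up to order $m$ extend continuously to $\overline\Omega$; values of derivatives on $\partial\Omega$ are those of the extensions. $\|\cdot\|$ is the $L^2(\Omega)$ norm, $I_{cv}(\mathbf u,\mathbf v)=\int_\Omega(\mathbf u\cdot\nabla\mathbf u)\cdot\mathbf v\,dV$, and $\mathbf u=\mathscr P\mathbf v$ (Leray–Helmholtz projection) means that $\mathbf v=\mathbf u+\nabla\phi$ in $\Omega$ for some $\phi\in C^1(\overline\Omega)$, where $\mathbf u\in C^1(\overline\Omega)$, $\nabla\cdot\mathbf u=0$ in $\Omega$ and $\mathbf n\cdot\mathbf u=0$ on $\partial\Omega$.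 Let $\nu>0$, $\lambda\ge 0$, $k>0$, $t_0\in\mathbb R$, let $\mathbf g(t,x)$ be an external force, and let $(A,\mathbf b,\mathbf c)$ be a real $s$-stage Runge–Kutta method that is algebraically stable, i.e. $b_i\ge 0$ for all $i$ and the matrix with entries $m_{i,j}=b_ia_{i,j}+b_ja_{j,i}-b_ib_j$ is positive semidefinite. A step $n\to n+1$ of the GePUP-ES-RK scheme consists of fields $\mathbf w^n,\mathbf w^{n+1}\in C^1(\overline\Omega)$, numbers $r^n,r^{n+1}$, a field $\mathbf u^{n+1}$ and, for $i=1,\dots,s$, of $\mathbf w^{(i)}\in C^3(\overline\Omega)$, $q^{(i)}\in C^2(\overline\Omega)$, arbitrary given $\widetilde{\mathbf u}^{(i)}\in C^2(\overline\Omega)$, a field $\mathbf u^{(i)}$, a number $r^{(i)}$, and $\mathbf g^{(i)}=\mathbf g(t_0+nk+c_ik,\cdot)\in C^1(\overline\Omega)$ (the stage quantities may differ from step to step) such that, for every $i$ and with $$\boldsymbol\rho^{(i)}:=\mathbf g^{(i)}-r^{(i)}\widetilde{\mathbf u}^{(i)}\cdot\nabla\widetilde{\mathbf u}^{(i)}-\nabla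 q^{(i)}+\nu\Delta\mathbf w^{(i)},$$ one has $$\begin{aligned} &\Delta q^{(i)}=\nabla\cdot(\mathbf g^{(i)}-r^{(i)}\widetilde{\mathbf u}^{(i)}\cdot\nabla\widetilde{\mathbf u}^{(i)})\ \text{in }\Omega,\\ &\mathbf n\cdot\nabla q^{(i)}=\mathbf n\cdot(\mathbf g^{(i)}-r^{(i)}\widetilde{\mathbf u}^{(i)}\cdot\nabla\widetilde{\mathbf u}^{(i)}+\nu\Delta\mathbf w^{(i)})+\lambda\,\mathbf n\cdot\mathbf w^{(i)}\ \text{on }\partial\Omega,\\ &\textstyle\mathbf w^{(i)}=\mathbf w^n+k\sum_ja_{i,j}\boldsymbol\rho^{(j)}\ \text{in }\Omega,\qquad \mathbf w^{(i)}\cdot\boldsymbol\tau=0,\ \nabla\cdot\mathbf w^{(i)}=0\ \text{on }\partial\Omega,\\ &\textstyle r^{(i)}=r^n+k\sum_ja_{i,j}I_{cv}(\widetilde{\mathbf u}^{(j)},\mathbf u^{(j)}),\qquad \mathbf u^{(i)}=\mathscr P\mathbf w^{(i)},\ \mathbf n\cdot\mathbf u^{(i)}=0\text{ on }\partial\Omega,\\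 &\textstyle\mathbf w^{n+1}=\mathbf w^n+k\sum_ib_i\boldsymbol\rho^{(i)}\ \text{in }\Omega,\qquad r^{n+1}=r^n+k\sum_ib_iI_{cv}(\widetilde{\mathbf u}^{(i)},\mathbf u^{(i)}),\\ &\mathbf u^{n+1}=\mathscr P\mathbf w^{n+1},\ \mathbf n\cdot\mathbf u^{n+1}=0\text{ on }\partial\Omega . \end{aligned}$$ Suppose that the steps $n\to n+1$ with $0\le n<N$, where $N\in\mathbb N\cup\{\infty\}$, form a run of this scheme, and that $\mathbf w^0=\mathbf u^0$ on $\partial\Omega$, where $\mathbf u^0$ is the initial velocity. Then for every $n<N$ $$\|\nabla\cdot\mathbf w^{n+1}\|^2-\|\nabla\cdot\mathbf w^n\|^2\le-2k\nu\sum_{i=1}^sb_i\|\nabla(\nabla\cdot\mathbf w^{(i)})\|^2,$$ and at every $x\in\partial\Omega$ with an outward unit normal $\mathbf n$ as above $$|\mathbf n\cdot\mathbf w^{n+1}(x)|^2-|\mathbf n\cdot\mathbf w^n(x)|^2\le-2k\lambda\sum_{i=1}^sb_i|\mathbf n\cdot\mathbf w^{(i)}(x)|^2 .$$ -/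

import Mathlib

noncomputable section

namespace GePUP

open Topology

/-- The ambient space `ℝ^d`. -/
abbrev Space (d : ℕ) : Type := EuclideanSpace ℝ (Fin d)

section Fields

variable {d : ℕ}

/-- A domain: a bounded connected open subset of `ℝ^d`. -/
structure IsBoundedDomain (Ω : Set (Space d)) : Prop where
  isOpen : IsOpen Ω
  isConnected : IsConnected Ω
  isBounded : Bornology.IsBounded Ω

/-- `e` is the outward unit normal of `Ω` at the boundary point `x`: near `x` the set `Ω` is the
sublevel set `{ψ < 0}` of a `C¹` function `ψ` without critical points, and `e` is the normalized
gradient of `ψ` at `x`. -/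
def IsOutwardUnitNormal (Ω : Set (Space d)) (x e : Space d) : Prop :=
  x ∈ frontier Ω ∧ ∃ (U : Set (Space d)) (ψ : Space d → ℝ),
    IsOpen U ∧ x ∈ U ∧ ContDiffOn ℝ 1 ψ U ∧ (∀ y ∈ U, gradient ψ y ≠ 0) ∧
    Ω ∩ U = {y ∈ U | ψ y < 0} ∧ e = ‖gradient ψ x‖⁻¹ • gradient ψ x

/-- `f ∈ C^m(closure Ω)`: `f` is continuous on the closure of `Ω`, of class `C^m` in the open set
`Ω`, and all its derivatives up to order `m` extend continuously to the closure. -/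
def ContDiffUpToBoundary {F : Type*} [NormedAddCommGroup F] [NormedSpace ℝ F]
    (m : ℕ) (Ω : Set (Space d)) (f : Space d → F) : Prop :=
  ContinuousOn f (closure Ω) ∧ ContDiffOn ℝ m f Ω ∧
    ∀ j ≤ m, ∃ G : Space d → ContinuousMultilinearMap ℝ (fun _ : Fin j => Space d) F,
      ContinuousOn G (closure Ω) ∧ Set.EqOn G (iteratedFDeriv ℝ j f) Ω

/-- Boundary values: the limit of `f` at `x` from inside `Ω`. -/
def boundaryValue {F : Type*} [TopologicalSpace F]
    (Ω : Set (Space d)) (f : Space d → F) (x : Space d) : F :=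
  extendFrom Ω f x

/-- The divergence `∇ ⬝ v = ∑ i, ∂ v_i / ∂ x_i`. -/
def divergence (v : Space d → Space d) (x : Space d) : ℝ :=
  ∑ i : Fin d, fderiv ℝ v x (EuclideanSpace.single i 1) i

/-- The convective derivative `u ⬝ ∇ v`. -/
def convection (u v : Space d → Space d) (x : Space d) : Space d :=
  fderiv ℝ v x (u x)

/-- The `L²` inner product over `Ω`. -/
def l2Inner {F : Type*} [NormedAddCommGroup F] [InnerProductSpace ℝ F]
    (Ω : Set (Space d)) (f h : Space d → F) : ℝ :=
  ∫ x in Ω, inner ℝ (f x) (h x)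

/-- The `L²` norm over `Ω`. -/
def l2Norm {F : Type*} [NormedAddCommGroup F] [InnerProductSpace ℝ F]
    (Ω : Set (Space d)) (f : Space d → F) : ℝ :=
  Real.sqrt (l2Inner Ω f f)

/-- The trilinear convection integral `I_cv(u, v) = ∫_Ω (u ⬝ ∇ u) ⬝ v`. -/
def convectionIntegral (Ω : Set (Space d)) (u v : Space d → Space d) : ℝ :=
  l2Inner Ω (convection u u) v

/-- `u = 𝒫 v` for the Leray-Helmholtz projection `𝒫`: `v = u + ∇ φ` in `Ω` where `u` is
divergence-free and has vanishing normal component on the boundary. -/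
def IsLerayProjection (Ω : Set (Space d)) (v u : Space d → Space d) : Prop :=
  ContDiffUpToBoundary 1 Ω u ∧
    (∀ x ∈ Ω, divergence u x = 0) ∧
    (∀ x e, IsOutwardUnitNormal Ω x e → inner ℝ e (u x) = 0) ∧
    ∃ φ : Space d → ℝ, ContDiffUpToBoundary 1 Ω φ ∧ ∀ x ∈ Ω, v x = u x + gradient φ x

end Fields

/-- An `s`-stage Runge-Kutta method `(A, b, c)`. -/
structure RKMethod (s : ℕ) where
  A : Matrix (Fin s) (Fin s) ℝ
  b : Fin s → ℝ
  c : Fin s → ℝ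

/-- The matrix `m_{ij} = b_i a_{ij} + b_j a_{ji} - b_i b_j`. -/
def RKMethod.stabilityMatrix {s : ℕ} (R : RKMethod s) : Matrix (Fin s) (Fin s) ℝ :=
  Matrix.of fun i j => R.b i * R.A i j + R.b j * R.A j i - R.b i * R.b j

/-- Algebraic stability of a Runge-Kutta method. -/
structure RKMethod.AlgebraicallyStable {s : ℕ} (R : RKMethod s) : Prop where
  weights_nonneg : ∀ i, 0 ≤ R.b i
  posSemidef : R.stabilityMatrix.PosSemidef

/-- The data of the problem and of the time discretization: the domain `Ω`, the external force
`g(t, x)`, the viscosity `ν`, the penalty parameter `lam`, the step size `k`, the initial time. -/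
structure Problem (d : ℕ) where
  Ω : Set (Space d)
  g : ℝ → Space d → Space d
  ν : ℝ
  lam : ℝ
  k : ℝ
  t₀ : ℝ

/-- The standing assumptions on the data. -/
structure Problem.Admissible {d : ℕ} (P : Problem d) : Prop where
  isDomain : IsBoundedDomain P.Ω
  ν_pos : 0 < P.ν
  lam_nonneg : 0 ≤ P.lam
  k_pos : 0 < P.k

/-- The quantities computed by a scheme with `s` stages. At time level `n`: the velocities `w n`
and `u n`, with `u 0` the initial velocity, and the scalar auxiliary variable `r n`. In the step from level `n` to level `n + 1`, at
stage `i`: the velocities `wS n i` and `uS n i`, the explicit approximation `uT n i`, the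
scalar `qS n i` and the auxiliary variable `rS n i`. -/
structure Trajectory (d s : ℕ) where
  w : ℕ → Space d → Space d
  u : ℕ → Space d → Space d
  r : ℕ → ℝ
  wS : ℕ → Fin s → Space d → Space d
  uS : ℕ → Fin s → Space d → Space d
  uT : ℕ → Fin s → Space d → Space d
  qS : ℕ → Fin s → Space d → ℝ
  rS : ℕ → Fin s → ℝ

section Scheme

variable {d s : ℕ}

/-- The external force `g^{(i)}` at stage `i` of step `n`, at time `t_n + c_i k`. -/
def stageForce (P : Problem d) (R : RKMethod s) (n : ℕ) (i : Fin s) : Space d → Space d :=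
  P.g (P.t₀ + n * P.k + R.c i * P.k)

/-- The field `g^{(i)} - r^{(i)} ũ^{(i)} ⬝ ∇ ũ^{(i)}`. -/
def stageExplicit (P : Problem d) (R : RKMethod s) (T : Trajectory d s) (n : ℕ) (i : Fin s) :
    Space d → Space d :=
  fun x => stageForce P R n i x - T.rS n i • convection (T.uT n i) (T.uT n i) x

/-- The stage slope
`ρ^{(i)} = g^{(i)} - r^{(i)} ũ^{(i)} ⬝ ∇ ũ^{(i)} - ∇ q^{(i)} + ν Δ w^{(i)}`. -/
def stageSlope (P : Problem d) (R : RKMethod s) (T : Trajectory d s) (n : ℕ) (i : Fin s) :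
    Space d → Space d :=
  fun x => stageExplicit P R T n i x - gradient (T.qS n i) x
    + P.ν • Laplacian.laplacian (T.wS n i) x

/-- The equations of the step from time level `n` to time level `n + 1`, for fields that are
smooth enough for all terms to make sense classically. -/
structure IsStep (P : Problem d) (R : RKMethod s) (T : Trajectory d s) (n : ℕ) : Prop where
  w_reg : ContDiffUpToBoundary 1 P.Ω (T.w n)
  w_succ_reg : ContDiffUpToBoundary 1 P.Ω (T.w (n + 1))
  force_reg : ∀ i, ContDiffUpToBoundary 1 P.Ω (stageForce P R n i)
  wS_reg : ∀ i, ContDiffUpToBoundary 3 P.Ω (T.wS n i)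
  uT_reg : ∀ i, ContDiffUpToBoundary 2 P.Ω (T.uT n i)
  qS_reg : ∀ i, ContDiffUpToBoundary 2 P.Ω (T.qS n i)
  /-- `Δ q^{(i)} = ∇ ⬝ (g^{(i)} - r^{(i)} ũ^{(i)} ⬝ ∇ ũ^{(i)})` in `Ω` -/
  laplacian_q : ∀ i, ∀ x ∈ P.Ω,
    Laplacian.laplacian (T.qS n i) x = divergence (stageExplicit P R T n i) x
  /-- `n ⬝ ∇ q^{(i)} = n ⬝ (g^{(i)} - r^{(i)} ũ^{(i)} ⬝ ∇ ũ^{(i)} + ν Δ w^{(i)}) + λ n ⬝ w^{(i)}`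
  on the boundary -/
  normal_q : ∀ i, ∀ x e, IsOutwardUnitNormal P.Ω x e →
    inner ℝ e (boundaryValue P.Ω (gradient (T.qS n i)) x) =
      inner ℝ e (boundaryValue P.Ω (fun y => stageExplicit P R T n i y
        + P.ν • Laplacian.laplacian (T.wS n i) y) x) + P.lam * inner ℝ e (T.wS n i x)
  stage_w : ∀ i, ∀ x ∈ P.Ω,
    T.wS n i x = T.w n x + P.k • ∑ j, R.A i j • stageSlope P R T n j x
  /-- `w^{(i)} ⬝ τ = 0` for all vectors `τ` tangent to the boundary -/
  tangential_w : ∀ i, ∀ x e, IsOutwardUnitNormal P.Ω x e →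
    ∀ τ : Space d, inner ℝ e τ = 0 → inner ℝ (T.wS n i x) τ = 0
  /-- `∇ ⬝ w^{(i)} = 0` on the boundary -/
  divergence_w : ∀ i, ∀ x ∈ frontier P.Ω, boundaryValue P.Ω (divergence (T.wS n i)) x = 0
  stage_r : ∀ i,
    T.rS n i = T.r n + P.k * ∑ j, R.A i j * convectionIntegral P.Ω (T.uT n j) (T.uS n j)
  stage_u : ∀ i, IsLerayProjection P.Ω (T.wS n i) (T.uS n i)
  stage_u_normal : ∀ i, ∀ x e, IsOutwardUnitNormal P.Ω x e → inner ℝ e (T.uS n i x) = 0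
  w_succ : ∀ x ∈ P.Ω,
    T.w (n + 1) x = T.w n x + P.k • ∑ i, R.b i • stageSlope P R T n i x
  r_succ : T.r (n + 1)
    = T.r n + P.k * ∑ i, R.b i * convectionIntegral P.Ω (T.uT n i) (T.uS n i)
  u_succ : IsLerayProjection P.Ω (T.w (n + 1)) (T.u (n + 1))
  u_succ_normal : ∀ x e, IsOutwardUnitNormal P.Ω x e → inner ℝ e (T.u (n + 1) x) = 0

/-- A run of the GePUP-ES-RK scheme over `N` steps, where `N = ⊤` is allowed. -/
def IsGePUPESRK (P : Problem d) (R : RKMethod s) (N : ℕ∞) (T : Trajectory d s) : Prop :=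
  ∀ n : ℕ, (n : ℕ∞) < N → IsStep P R T n

end Scheme

end GePUP

end

/-!
Both inequalities come from the same algebraic fact about Runge-Kutta methods. For scalars
`Y_i = y₀ + k ∑ a_ij f_j` and `y₁ = y₀ + k ∑ b_i f_i` one has
`y₁² - y₀² = 2k ∑ b_i Y_i f_i - k² ∑ m_ij f_i f_j`, and algebraic stability makes the last sum
nonnegative (`RKMethod.AlgebraicallyStable.sq_sub_sq_le`).

* On the boundary it is applied to the normal components `Y_i = n ⬝ w^{(i)}(x)`. The Neumann condition
  for `q^{(i)}` says exactly that the boundary limit of `n ⬝ ρ^{(i)}` is `-λ n ⬝ w^{(i)}`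
  (`IsStep.exists_tendsto_stageSlope`), so `Y_i f_i = -λ Y_i²`.
* In the interior it is applied, pointwise, to the divergences `Y_i = ∇ ⬝ w^{(i)}(x)`. The Poisson
  equation for `q^{(i)}` cancels the explicit terms, which leaves `f_i = ν Δ(∇ ⬝ w^{(i)})`
  (`IsStep.divergence_stageSlope`). Integrating over `Ω` and using Green's identity for
  `∇ ⬝ w^{(i)}`, which vanishes on the boundary, turns `∫ Y_i f_i` into `-ν ‖∇(∇ ⬝ w^{(i)})‖²`.

The boundary of `Ω` is not assumed regular, so Green's identity cannot be taken from a divergence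
theorem for smooth domains. Since `f = 0` on the boundary, the truncation `η(n f) / n`, with `η` smooth,
zero near `0` and the identity far from `0`, has compact support in `Ω`, and integration by parts
against it involves no boundary term. As `n → ∞` the truncations converge to `f`, and their
gradients converge to `∇f` wherever `f ≠ 0`. On `{f = 0}` they are zero, which is harmless because
`∇f = 0` almost everywhere there (`ae_fderiv_eq_zero_of_eq_zero`, `integral_mul_fderiv_eq_neg`).
-/

namespace GePUP

open Topology MeasureTheory Filter Set

/-! ### Algebraic stability -/

/-- The energy estimate of an algebraically stable method with stage values `Y` and slopes `f`.
The slope `f i` need not be a function of `Y i`. -/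
theorem RKMethod.AlgebraicallyStable.sq_sub_sq_le {s : ℕ} {R : RKMethod s}
    (hR : R.AlgebraicallyStable) (k y₀ y₁ : ℝ) (Y f : Fin s → ℝ)
    (hY : ∀ i, Y i = y₀ + k * ∑ j, R.A i j * f j)
    (hy : y₁ = y₀ + k * ∑ i, R.b i * f i) :
    y₁ ^ 2 - y₀ ^ 2 ≤ 2 * k * ∑ i, R.b i * (Y i * f i) := by
  have hM : 0 ≤ ∑ i, ∑ j, R.stabilityMatrix i j * (f i * f j) := by
    have h := hR.posSemidef.dotProduct_mulVec_nonneg f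
    simp only [dotProduct, Matrix.mulVec, Finset.mul_sum, star_trivial] at h
    refine h.trans_eq (Finset.sum_congr rfl fun i _ => Finset.sum_congr rfl fun j _ => by ring)
  set S := ∑ i, R.b i * f i with hS
  set Q := ∑ i, ∑ j, R.b i * R.A i j * (f i * f j) with hQ
  have h1 : ∑ i, R.b i * (Y i * f i) = y₀ * S + k * Q := by
    rw [hS, hQ, Finset.mul_sum, Finset.mul_sum, ← Finset.sum_add_distrib]
    refine Finset.sum_congr rfl fun i _ => ?_
    rw [hY i]
    have : ∑ j, R.b i * R.A i j * (f i * f j) = R.b i * f i * ∑ j, R.A i j * f j := by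
      rw [Finset.mul_sum]; exact Finset.sum_congr rfl fun j _ => by ring
    rw [this]; ring
  have h2 : ∑ i, ∑ j, R.stabilityMatrix i j * (f i * f j) = 2 * Q - S ^ 2 := by
    have hQ' : Q = ∑ i, ∑ j, R.b j * R.A j i * (f i * f j) := by
      rw [hQ, Finset.sum_comm]
      exact Finset.sum_congr rfl fun i _ => Finset.sum_congr rfl fun j _ => by ring
    have hS' : S ^ 2 = ∑ i, ∑ j, R.b i * R.b j * (f i * f j) := by
      rw [sq, hS, Finset.sum_mul_sum]
      exact Finset.sum_congr rfl fun i _ => Finset.sum_congr rfl fun j _ => by ring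
    rw [two_mul]
    nth_rw 2 [hQ']
    rw [hS', hQ, ← Finset.sum_add_distrib, ← Finset.sum_sub_distrib]
    refine Finset.sum_congr rfl fun i _ => ?_
    rw [← Finset.sum_add_distrib, ← Finset.sum_sub_distrib]
    refine Finset.sum_congr rfl fun j _ => ?_
    simp only [RKMethod.stabilityMatrix, Matrix.of_apply]
    ring
  rw [h2] at hM
  rw [h1, hy]
  nlinarith [mul_nonneg (sq_nonneg k) hM]

/-! ### Functions and derivatives that extend continuously to the closure -/

section Extension

variable {d : ℕ} {Ω : Set (Space d)}
variable {F G H : Type*} [NormedAddCommGroup F] [NormedAddCommGroup G] [NormedAddCommGroup H]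

/-- `f` agrees on `Ω` with a function that is continuous on the closure of `Ω`. The values of `f`
outside `Ω` play no role. -/
def HasContinuousExtension (Ω : Set (Space d)) (f : Space d → F) : Prop :=
  ∃ g : Space d → F, ContinuousOn g (closure Ω) ∧ EqOn g f Ω

namespace HasContinuousExtension

theorem congr {f g : Space d → F} (hf : HasContinuousExtension Ω f) (h : EqOn f g Ω) :
    HasContinuousExtension Ω g := by
  obtain ⟨f', h1, h2⟩ := hf
  exact ⟨f', h1, h2.trans h⟩

theorem comp {f : Space d → F} {φ : F → G} (hφ : Continuous φ)
    (hf : HasContinuousExtension Ω f) : HasContinuousExtension Ω (fun x => φ (f x)) := by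
  obtain ⟨f', h1, h2⟩ := hf
  exact ⟨fun x => φ (f' x), hφ.comp_continuousOn h1, fun x hx => congrArg φ (h2 hx)⟩

theorem comp₂ {f : Space d → F} {g : Space d → G} {φ : F × G → H} (hφ : Continuous φ)
    (hf : HasContinuousExtension Ω f) (hg : HasContinuousExtension Ω g) :
    HasContinuousExtension Ω (fun x => φ (f x, g x)) := by
  obtain ⟨f', h1, h2⟩ := hf
  obtain ⟨g', h3, h4⟩ := hg
  exact ⟨fun x => φ (f' x, g' x), hφ.comp_continuousOn (h1.prodMk h3),
    fun x hx => by simp only [h2 hx, h4 hx]⟩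

theorem add {f g : Space d → F} (hf : HasContinuousExtension Ω f)
    (hg : HasContinuousExtension Ω g) : HasContinuousExtension Ω (fun x => f x + g x) :=
  comp₂ (φ := fun p : F × F => p.1 + p.2) (by fun_prop) hf hg

theorem sub {f g : Space d → F} (hf : HasContinuousExtension Ω f)
    (hg : HasContinuousExtension Ω g) : HasContinuousExtension Ω (fun x => f x - g x) :=
  comp₂ (φ := fun p : F × F => p.1 - p.2) (by fun_prop) hf hg

theorem mul {f g : Space d → ℝ} (hf : HasContinuousExtension Ω f)
    (hg : HasContinuousExtension Ω g) : HasContinuousExtension Ω (fun x => f x * g x) :=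
  comp₂ (φ := fun p : ℝ × ℝ => p.1 * p.2) (by fun_prop) hf hg

theorem const_smul [NormedSpace ℝ F] {f : Space d → F} (c : ℝ) (hf : HasContinuousExtension Ω f) :
    HasContinuousExtension Ω (fun x => c • f x) :=
  comp (φ := fun p : F => c • p) (by fun_prop) hf

theorem sum {ι : Type*} (t : Finset ι) {f : ι → Space d → F}
    (hf : ∀ i, HasContinuousExtension Ω (f i)) :
    HasContinuousExtension Ω (fun x => ∑ i ∈ t, f i x) := by
  choose g h1 h2 using hf
  exact ⟨fun x => ∑ i ∈ t, g i x, continuousOn_finsetSum _ fun i _ => h1 i,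
    fun x hx => Finset.sum_congr rfl fun i _ => h2 i hx⟩

/-- The boundary value is the limit from inside. -/
theorem tendsto_boundaryValue {f : Space d → F} (hf : HasContinuousExtension Ω f) {x : Space d}
    (hx : x ∈ closure Ω) : Tendsto f (𝓝[Ω] x) (𝓝 (boundaryValue Ω f x)) := by
  obtain ⟨g, h1, h2⟩ := hf
  refine tendsto_extendFrom ⟨g x, ?_⟩
  exact ((h1 x hx).mono_left (nhdsWithin_mono x subset_closure)).congr'
    (h2.eventuallyEq_of_mem self_mem_nhdsWithin)

theorem integrableOn {f : Space d → F} (hf : HasContinuousExtension Ω f)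
    (hΩ : IsBoundedDomain Ω) : IntegrableOn f Ω := by
  obtain ⟨g, h1, h2⟩ := hf
  have hc : IsCompact (closure Ω) := hΩ.isBounded.isCompact_closure
  exact ((h1.integrableOn_compact hc).mono_set subset_closure).congr_fun h2
    hΩ.isOpen.measurableSet

end HasContinuousExtension

variable [NormedSpace ℝ F] [NormedSpace ℝ G]

/-- `f` is `C^m` in `Ω` and its derivatives up to order `m` extend continuously to the closure.
Unlike `ContDiffUpToBoundary` this does not depend on the values of `f` outside `Ω`, so it passes
to derivatives of `f`. -/
structure ExtendsContDiff (m : ℕ) (Ω : Set (Space d)) (f : Space d → F) : Prop where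
  contDiffOn : ContDiffOn ℝ m f Ω
  ext : ∀ j ≤ m, HasContinuousExtension Ω (iteratedFDeriv ℝ j f)

theorem ContDiffUpToBoundary.extends {m : ℕ} {f : Space d → F}
    (hf : ContDiffUpToBoundary m Ω f) : ExtendsContDiff m Ω f := ⟨hf.2.1, hf.2.2⟩

namespace ExtendsContDiff

variable {m : ℕ} {f : Space d → F}

theorem contDiffAt (hf : ExtendsContDiff m Ω f) (hΩ : IsOpen Ω) {x : Space d} (hx : x ∈ Ω) :
    ContDiffAt ℝ m f x := hf.contDiffOn.contDiffAt (hΩ.mem_nhds hx)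

theorem differentiableAt (hf : ExtendsContDiff (m + 1) Ω f) (hΩ : IsOpen Ω) {x : Space d}
    (hx : x ∈ Ω) : DifferentiableAt ℝ f x :=
  (hf.contDiffAt hΩ hx).differentiableAt (by simp)

theorem of_succ (hf : ExtendsContDiff (m + 1) Ω f) : ExtendsContDiff m Ω f :=
  ⟨hf.contDiffOn.of_le (by simp), fun j hj => hf.ext j (by omega)⟩

theorem hasContinuousExtension (hf : ExtendsContDiff m Ω f) : HasContinuousExtension Ω f :=
  ((hf.ext 0 (Nat.zero_le m)).comp
    (continuousMultilinearCurryFin0 ℝ (Space d) F).continuous).congr fun x _ => by simp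

theorem fderiv (hf : ExtendsContDiff (m + 1) Ω f) (hΩ : IsOpen Ω) :
    ExtendsContDiff m Ω (_root_.fderiv ℝ f) := by
  refine ⟨hf.contDiffOn.fderiv_of_isOpen hΩ (by simp), fun j hj => ?_⟩
  refine ((hf.ext (j + 1) (by omega)).comp
    (continuousMultilinearCurryRightEquiv' ℝ j (Space d) F).continuous).congr fun x _ => ?_
  simp only [iteratedFDeriv_succ_eq_comp_right, Function.comp_apply,
    LinearIsometryEquiv.apply_symm_apply]

theorem clm_comp (hf : ExtendsContDiff m Ω f) (hΩ : IsOpen Ω) (L : F →L[ℝ] G) :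
    ExtendsContDiff m Ω (fun x => L (f x)) := by
  refine ⟨L.contDiff.comp_contDiffOn hf.contDiffOn, fun j hj => ?_⟩
  refine ((hf.ext j hj).comp
    (ContinuousLinearMap.compContinuousMultilinearMapL ℝ (fun _ : Fin j => Space d) F G
      L).continuous).congr fun x hx => ?_
  exact (L.iteratedFDeriv_comp_left (hf.contDiffAt hΩ hx) (by exact_mod_cast hj)).symm

theorem fderiv_apply (hf : ExtendsContDiff (m + 1) Ω f) (hΩ : IsOpen Ω) (v : Space d) :
    ExtendsContDiff m Ω (fun x => _root_.fderiv ℝ f x v) :=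
  (hf.fderiv hΩ).clm_comp hΩ (ContinuousLinearMap.apply ℝ F v)

theorem sum {ι : Type*} (t : Finset ι) {f : ι → Space d → F} (hΩ : IsOpen Ω)
    (hf : ∀ i, ExtendsContDiff m Ω (f i)) : ExtendsContDiff m Ω (fun x => ∑ i ∈ t, f i x) := by
  refine ⟨ContDiffOn.sum fun i _ => (hf i).contDiffOn, fun j hj => ?_⟩
  refine (HasContinuousExtension.sum t fun i => (hf i).ext j hj).congr fun x hx => ?_
  exact (iteratedFDeriv_fun_sum_apply fun i _ => ((hf i).contDiffAt hΩ hx).of_le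
    (by exact_mod_cast hj)).symm

end ExtendsContDiff

end Extension

/-! ### Integration by parts for functions vanishing on the boundary -/

section Truncation

/-- The profile of the truncation: a smooth function that vanishes on `[-1, 1]` and is the identity
where `2 ≤ t²`. -/
noncomputable def cutoffId (t : ℝ) : ℝ := t * Real.smoothTransition (t ^ 2 - 1)

theorem contDiff_cutoffId : ContDiff ℝ 1 cutoffId := by
  unfold cutoffId
  have : ContDiff ℝ 1 Real.smoothTransition := Real.smoothTransition.contDiff (n := 1)
  fun_prop

theorem cutoffId_of_abs_le {t : ℝ} (ht : |t| ≤ 1) : cutoffId t = 0 := by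
  rw [cutoffId, Real.smoothTransition.zero_of_nonpos, mul_zero]
  have := (sq_le_one_iff_abs_le_one t).2 ht
  linarith

theorem cutoffId_of_two_le_abs {t : ℝ} (ht : 2 ≤ |t|) : cutoffId t = t := by
  rw [cutoffId, Real.smoothTransition.one_of_one_le, mul_one]
  nlinarith [sq_abs t]

theorem abs_cutoffId_le (t : ℝ) : |cutoffId t| ≤ |t| := by
  rw [cutoffId, abs_mul, abs_of_nonneg (Real.smoothTransition.nonneg _)]
  exact mul_le_of_le_one_right (abs_nonneg t) (Real.smoothTransition.le_one _)

theorem deriv_cutoffId_of_two_lt_abs {t : ℝ} (ht : 2 < |t|) : deriv cutoffId t = 1 := by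
  have h : cutoffId =ᶠ[𝓝 t] id := by
    filter_upwards [continuous_abs.continuousAt.eventually_const_lt ht] with y hy
    exact cutoffId_of_two_le_abs hy.le
  rw [h.deriv_eq, deriv_id]

theorem exists_abs_deriv_cutoffId_le : ∃ C, ∀ t, |deriv cutoffId t| ≤ C := by
  obtain ⟨C, hC⟩ := (isCompact_Icc (a := (-2 : ℝ)) (b := 2)).exists_bound_of_continuousOn
    (contDiff_cutoffId.continuous_deriv le_rfl).continuousOn
  refine ⟨max C 1, fun t => ?_⟩
  rcases le_or_gt |t| 2 with h | h
  · exact (hC t (abs_le.1 h)).trans (le_max_left _ _)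
  · rw [deriv_cutoffId_of_two_lt_abs h, abs_one]
    exact le_max_right _ _

end Truncation

section Green

variable {d : ℕ} {Ω : Set (Space d)}

/-- The derivative of a function vanishes almost everywhere on its zero set: at a density point of
that set the difference quotients vanish along a set of full density. -/
theorem ae_fderiv_eq_zero_of_eq_zero (hΩ : IsOpen Ω) {f : Space d → ℝ}
    (hf : DifferentiableOn ℝ f Ω) :
    ∀ᵐ x ∂volume.restrict Ω, f x = 0 → fderiv ℝ f x = 0 := by
  rcases subsingleton_or_nontrivial (Space d) with h | h
  · exact Eventually.of_forall fun x _ => ContinuousLinearMap.ext fun v => by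
      rw [Subsingleton.elim v 0, map_zero, map_zero]
  obtain ⟨v, hv⟩ := exists_ne (0 : Space d)
  set s : Set (Space d) := Ω ∩ f ⁻¹' {0} with hs
  have hsm : MeasurableSet s := by
    obtain ⟨u, hu, hu'⟩ := (continuousOn_iff_isClosed.1 hf.continuousOn) {0} isClosed_singleton
    rw [hs, inter_comm, hu']
    exact hu.measurableSet.inter hΩ.measurableSet
  -- `norm_fderiv_sub_le` concerns self-maps of a space, so it is applied to `f • v`
  have happ : ApproximatesLinearOn (fun x => f x • v) (0 : Space d →L[ℝ] Space d) s 0 := by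
    intro x hx y hy
    simp [show f x = 0 from hx.2, show f y = 0 from hy.2]
  have key := happ.norm_fderiv_sub_le volume hsm (fun x => (fderiv ℝ f x).smulRight v)
    fun x hx => ((hf.differentiableAt (hΩ.mem_nhds hx.1)).hasFDerivAt.smul_const v).hasFDerivWithinAt
  rw [ae_restrict_iff' hsm] at key
  rw [ae_restrict_iff' hΩ.measurableSet]
  filter_upwards [key] with x hx hxΩ hfx
  have h0 := hx ⟨hxΩ, hfx⟩
  simp only [sub_zero, nonpos_iff_eq_zero, nnnorm_eq_zero] at h0
  ext w
  have := congrArg (fun L : Space d →L[ℝ] Space d => L w) h0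
  simpa [hv] using this

theorem integral_fderiv_apply_eq_zero {f : Space d → ℝ} (v : Space d) (hf : Differentiable ℝ f)
    (hint : Integrable f) (hint' : Integrable fun x => fderiv ℝ f x v) :
    ∫ x, fderiv ℝ f x v = 0 := by
  have := integral_mul_fderiv_eq_neg_fderiv_mul_of_integrable (μ := volume) (𝕜 := ℝ)
    (f := fun _ : Space d => (1 : ℝ)) (g := f) (v := v) (by simp) (by simpa using hint')
    (by simpa using hint) (fun x _ => by fun_prop) (fun x _ => hf x)
  simpa using this

/-- Integration by parts for the truncation `η (n f) / n` of a function `f` that vanishes on the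
boundary: the product with `h` has compact support in `Ω`. -/
theorem integral_truncation_mul_fderiv (hΩ : IsBoundedDomain Ω) {f f' h : Space d → ℝ}
    (v : Space d) (hf : ExtendsContDiff 1 Ω f) (hh : ExtendsContDiff 1 Ω h)
    (hf'c : ContinuousOn f' (closure Ω)) (hf' : EqOn f' f Ω) (hf'0 : ∀ x ∈ frontier Ω, f' x = 0)
    {n : ℝ} (hn : 0 < n) :
    ∫ x in Ω, cutoffId (n * f x) / n * fderiv ℝ h x v
        + deriv cutoffId (n * f x) * (fderiv ℝ f x v * h x) = 0 := by
  have hcl : closure Ω = Ω ∪ frontier Ω := closure_eq_self_union_frontier Ω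
  -- `K` contains the support of the truncation in `Ω`; it is closed and stays away from the boundary
  set K : Set (Space d) := closure Ω ∩ (fun x => |f' x|) ⁻¹' Ici n⁻¹ with hK
  have hKc : IsClosed K := hf'c.abs.preimage_isClosed_of_isClosed isClosed_closure isClosed_Ici
  have hKΩ : K ⊆ Ω := by
    rintro x ⟨hx, hx'⟩
    rcases hcl ▸ hx with hx | hx
    · exact hx
    · rw [mem_preimage, hf'0 x hx, abs_zero, mem_Ici] at hx'
      exact absurd hx' (not_le.2 (inv_pos.2 hn))
  have hzero : ∀ x ∈ Ω, x ∉ K → cutoffId (n * f x) = 0 := by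
    intro x hx hxK
    apply cutoffId_of_abs_le
    have : |f x| < n⁻¹ := by
      by_contra hcon
      exact hxK ⟨subset_closure hx, by rw [mem_preimage, hf' hx]; exact not_lt.1 hcon⟩
    rw [abs_mul, abs_of_pos hn]
    calc n * |f x| ≤ n * n⁻¹ := by gcongr
      _ = 1 := mul_inv_cancel₀ hn.ne'
  set F : Space d → ℝ := Ω.indicator fun x => cutoffId (n * f x) / n * h x with hF
  set F' : Space d → ℝ := Ω.indicator fun x => cutoffId (n * f x) / n * fderiv ℝ h x v
        + deriv cutoffId (n * f x) * (fderiv ℝ f x v * h x) with hF'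
  have hout : ∀ x ∉ Ω, F =ᶠ[𝓝 x] fun _ => 0 := by
    intro x hx
    filter_upwards [hKc.isOpen_compl.mem_nhds fun h => hx (hKΩ h)] with y hy
    by_cases hyΩ : y ∈ Ω
    · rw [hF, indicator_of_mem hyΩ, hzero y hyΩ hy]; simp
    · rw [hF, indicator_of_notMem hyΩ]
  have hin : ∀ x ∈ Ω, HasFDerivAt F ((cutoffId (n * f x) / n) • fderiv ℝ h x
      + h x • ((deriv cutoffId (n * f x)) • fderiv ℝ f x)) x := by
    intro x hx
    have h1 : HasFDerivAt (fun y => cutoffId (n * f y) / n)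
        ((deriv cutoffId (n * f x)) • fderiv ℝ f x) x := by
      have h2 := ((contDiff_cutoffId.differentiable (by simp)) (n * f x)).hasDerivAt
      have h3 := (hf.differentiableAt hΩ.isOpen hx).hasFDerivAt.const_mul n
      have h4 := (h2.comp_hasFDerivAt x h3).mul_const n⁻¹
      simp only [Function.comp_def, ← div_eq_mul_inv] at h4
      refine h4.congr_fderiv ?_
      ext w
      simp only [smul_apply, smul_eq_mul]
      field_simp
    have h5 := h1.mul (hh.differentiableAt hΩ.isOpen hx).hasFDerivAt
    refine h5.congr_of_eventuallyEq ?_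
    filter_upwards [hΩ.isOpen.mem_nhds hx] with y hy
    rw [hF, indicator_of_mem hy, Pi.mul_apply]
  have hdiff : Differentiable ℝ F := by
    intro x
    by_cases hx : x ∈ Ω
    · exact (hin x hx).differentiableAt
    · exact (hout x hx).differentiableAt_iff.2 (by fun_prop)
  have hfd : (fun x => fderiv ℝ F x v) = F' := by
    funext x
    by_cases hx : x ∈ Ω
    · rw [(hin x hx).fderiv, hF', indicator_of_mem hx]
      simp only [add_apply, smul_apply, smul_eq_mul]
      ring
    · rw [(hout x hx).fderiv_eq, hF', indicator_of_notMem hx]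
      simp
  have hfe := hf.hasContinuousExtension
  have hhe := hh.hasContinuousExtension
  have hfe' := (hf.fderiv_apply hΩ.isOpen v).hasContinuousExtension
  have hhe' := (hh.fderiv_apply hΩ.isOpen v).hasContinuousExtension
  have hηe : HasContinuousExtension Ω fun x => cutoffId (n * f x) / n := by
    have hc := contDiff_cutoffId.continuous
    exact hfe.comp (φ := fun t => cutoffId (n * t) / n) (by fun_prop)
  have hηe' : HasContinuousExtension Ω fun x => deriv cutoffId (n * f x) := by
    have hc := contDiff_cutoffId.continuous_deriv le_rfl
    exact hfe.comp (φ := fun t => deriv cutoffId (n * t)) (by fun_prop)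
  have hFi : Integrable F :=
    ((hηe.mul hhe).integrableOn hΩ).integrable_indicator hΩ.isOpen.measurableSet
  have hFi' : Integrable F' :=
    (((hηe.mul hhe').add (hηe'.mul (hfe'.mul hhe))).integrableOn hΩ).integrable_indicator
      hΩ.isOpen.measurableSet
  have := integral_fderiv_apply_eq_zero v hdiff hFi (hfd ▸ hFi')
  rw [hfd, hF', integral_indicator hΩ.isOpen.measurableSet] at this
  exact this

/-- Integration by parts on a bounded domain without any regularity of the boundary, for a function
`f` that vanishes on the boundary. -/
theorem integral_mul_fderiv_eq_neg (hΩ : IsBoundedDomain Ω) {f h : Space d → ℝ}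
    (v : Space d) (hf : ExtendsContDiff 1 Ω f) (hh : ExtendsContDiff 1 Ω h)
    (hf0 : ∀ x ∈ frontier Ω, boundaryValue Ω f x = 0) :
    ∫ x in Ω, f x * fderiv ℝ h x v = -∫ x in Ω, fderiv ℝ f x v * h x := by
  obtain ⟨f', hf'c, hf'⟩ := hf.hasContinuousExtension
  have hf'0 : ∀ x ∈ frontier Ω, f' x = 0 := by
    intro x hx
    have hx' : x ∈ closure Ω := frontier_subset_closure hx
    rw [← hf0 x hx, boundaryValue]
    refine (extendFrom_eq hx' ?_).symm
    exact ((hf'c x hx').mono_left (nhdsWithin_mono x subset_closure)).congr'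
      (hf'.eventuallyEq_of_mem self_mem_nhdsWithin)
  obtain ⟨C, hC⟩ := exists_abs_deriv_cutoffId_le
  have hfe := hf.hasContinuousExtension
  have hhe := hh.hasContinuousExtension
  have hfe' := (hf.fderiv_apply hΩ.isOpen v).hasContinuousExtension
  have hhe' := (hh.fderiv_apply hΩ.isOpen v).hasContinuousExtension
  have hi1 := (hfe.mul hhe').integrableOn hΩ
  have hi2 := (hfe'.mul hhe).integrableOn hΩ
  have hpos : ∀ n : ℕ, (0 : ℝ) < n + 1 := fun n => by positivity
  set u : ℕ → Space d → ℝ := fun n x => cutoffId ((n + 1) * f x) / (n + 1) * fderiv ℝ h x v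
        + deriv cutoffId ((n + 1) * f x) * (fderiv ℝ f x v * h x) with hu
  have hu0 : ∀ n, ∫ x in Ω, u n x = 0 := fun n =>
    integral_truncation_mul_fderiv hΩ v hf hh hf'c hf' hf'0 (hpos n)
  have hlim : Tendsto (fun n => ∫ x in Ω, u n x) atTop
      (𝓝 (∫ x in Ω, f x * fderiv ℝ h x v + fderiv ℝ f x v * h x)) := by
    refine tendsto_integral_of_dominated_convergence
      (fun x => |f x * fderiv ℝ h x v| + C * |fderiv ℝ f x v * h x|) (fun n => ?_)
      (hi1.abs.add (hi2.abs.const_mul C)) (fun n => ?_) ?_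
    · have hc := contDiff_cutoffId.continuous
      have hc' := contDiff_cutoffId.continuous_deriv le_rfl
      exact (((hfe.comp (φ := fun t => cutoffId ((n + 1) * t) / (n + 1)) (by fun_prop)).mul
        hhe').add ((hfe.comp (φ := fun t => deriv cutoffId ((n + 1) * t)) (by fun_prop)).mul
        (hfe'.mul hhe)) |>.integrableOn hΩ).aestronglyMeasurable
    · refine Eventually.of_forall fun x => ?_
      have h1 : |cutoffId ((n + 1) * f x) / (n + 1)| ≤ |f x| := by
        rw [abs_div, abs_of_pos (hpos n), div_le_iff₀ (hpos n)]
        refine (abs_cutoffId_le _).trans ?_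
        rw [abs_mul, abs_of_pos (hpos n), mul_comm]
      refine (norm_add_le _ _).trans (add_le_add ?_ ?_)
      · rw [Real.norm_eq_abs, abs_mul, abs_mul]
        gcongr
      · rw [Real.norm_eq_abs, abs_mul]
        gcongr
        exact hC _
    · filter_upwards [ae_fderiv_eq_zero_of_eq_zero hΩ.isOpen
        (hf.contDiffOn.differentiableOn (by simp))] with x hx
      -- on `{f = 0}` both sides vanish; elsewhere the sequence is eventually constant
      by_cases hfx : f x = 0
      · have : ∀ n, u n x = 0 := fun n => by
          simp [hu, hx hfx, hfx, cutoffId_of_abs_le]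
        simp [this, hx hfx, hfx]
      · refine tendsto_const_nhds.congr' ?_
        have hev : ∀ᶠ n : ℕ in atTop, 2 < ((n : ℝ) + 1) * |f x| :=
          ((tendsto_natCast_atTop_atTop.atTop_add tendsto_const_nhds).atTop_mul_const
            (abs_pos.2 hfx)).eventually_gt_atTop 2
        filter_upwards [hev] with n hn
        have hn' : 2 < |((n : ℝ) + 1) * f x| := by rwa [abs_mul, abs_of_pos (hpos n)]
        simp only [hu, cutoffId_of_two_le_abs hn'.le, deriv_cutoffId_of_two_lt_abs hn', one_mul]
        rw [mul_div_cancel_left₀ _ (hpos n).ne']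
  simp only [hu0] at hlim
  have h0 := tendsto_nhds_unique hlim tendsto_const_nhds
  rw [integral_add hi1 hi2] at h0
  linarith

end Green

/-! ### Divergence, gradient and Laplacian in coordinates -/

section Operators

variable {d : ℕ} {Ω : Set (Space d)} {F G : Type*} [NormedAddCommGroup F] [NormedSpace ℝ F]
  [NormedAddCommGroup G] [NormedSpace ℝ G]

theorem fderiv_clm_apply_comp (L : F →L[ℝ] G) {f : Space d → F} {x : Space d}
    (hf : DifferentiableAt ℝ f x) (v : Space d) :
    fderiv ℝ (fun y => L (f y)) x v = L (fderiv ℝ f x v) := by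
  have h : HasFDerivAt (fun y => L (f y)) (L.comp (fderiv ℝ f x)) x :=
    L.hasFDerivAt.comp x hf.hasFDerivAt
  rw [h.fderiv]
  rfl

theorem fderiv_coord {f : Space d → Space d} {x : Space d} (hf : DifferentiableAt ℝ f x)
    (i : Fin d) (v : Space d) : fderiv ℝ (fun y => f y i) x v = fderiv ℝ f x v i :=
  fderiv_clm_apply_comp (EuclideanSpace.proj (𝕜 := ℝ) i) hf v

theorem fderiv_fderiv_apply {f : Space d → F} {x : Space d} (hf : ContDiffAt ℝ 2 f x)
    (v w : Space d) : fderiv ℝ (fun y => fderiv ℝ f y v) x w = fderiv ℝ (fderiv ℝ f) x w v :=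
  fderiv_clm_apply_comp (ContinuousLinearMap.apply ℝ F v)
    ((hf.fderiv_right (m := 1) (by norm_num)).differentiableAt (by simp)) w

theorem fderiv_fderiv_comm {f : Space d → F} {x : Space d} (hf : ContDiffAt ℝ 2 f x)
    (v w : Space d) :
    fderiv ℝ (fun y => fderiv ℝ f y v) x w = fderiv ℝ (fun y => fderiv ℝ f y w) x v := by
  rw [fderiv_fderiv_apply hf, fderiv_fderiv_apply hf]
  exact hf.isSymmSndFDerivAt (by simp) w v

theorem laplacian_eq_sum {f : Space d → F} {x : Space d} (hf : ContDiffAt ℝ 2 f x) :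
    Laplacian.laplacian f x = ∑ i : Fin d,
      fderiv ℝ (fun y => fderiv ℝ f y (EuclideanSpace.single i 1)) x
        (EuclideanSpace.single i 1) := by
  rw [InnerProductSpace.laplacian_eq_iteratedFDeriv_orthonormalBasis f
    (EuclideanSpace.basisFun (Fin d) ℝ)]
  refine Finset.sum_congr rfl fun i _ => ?_
  rw [fderiv_fderiv_apply hf, iteratedFDeriv_two_apply]
  simp

theorem gradient_apply (f : Space d → ℝ) (x : Space d) (i : Fin d) :
    gradient f x i = fderiv ℝ f x (EuclideanSpace.single i 1) := by
  have := InnerProductSpace.toDual_symm_apply (𝕜 := ℝ) (x := EuclideanSpace.single i (1 : ℝ))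
    (y := fderiv ℝ f x)
  rw [← this, EuclideanSpace.inner_single_right]
  simp [gradient]

theorem differentiableAt_gradient {f : Space d → ℝ} {x : Space d} (hf : ContDiffAt ℝ 2 f x) :
    DifferentiableAt ℝ (gradient f) x := by
  rw [differentiableAt_euclidean]
  intro i
  simp only [gradient_apply]
  have := (hf.fderiv_right (m := 1) (by norm_num)).differentiableAt (by simp)
  fun_prop

theorem divergence_gradient {f : Space d → ℝ} {x : Space d} (hf : ContDiffAt ℝ 2 f x) :
    divergence (gradient f) x = Laplacian.laplacian f x := by
  rw [laplacian_eq_sum hf, divergence]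
  refine Finset.sum_congr rfl fun i _ => ?_
  rw [← fderiv_coord (differentiableAt_gradient hf)]
  simp only [gradient_apply]

theorem norm_gradient_sq (f : Space d → ℝ) (x : Space d) :
    ‖gradient f x‖ ^ 2 = ∑ i : Fin d, fderiv ℝ f x (EuclideanSpace.single i 1) ^ 2 := by
  rw [EuclideanSpace.norm_sq_eq]
  simp only [gradient_apply, Real.norm_eq_abs, sq_abs]

theorem divergence_add {u v : Space d → Space d} {x : Space d} (hu : DifferentiableAt ℝ u x)
    (hv : DifferentiableAt ℝ v x) :
    divergence (fun y => u y + v y) x = divergence u x + divergence v x := by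
  simp only [divergence, fderiv_fun_add hu hv, ← Finset.sum_add_distrib]
  rfl

theorem divergence_const_smul {u : Space d → Space d} {x : Space d} (c : ℝ)
    (hu : DifferentiableAt ℝ u x) : divergence (fun y => c • u y) x = c * divergence u x := by
  simp only [divergence, fderiv_fun_const_smul hu, Finset.mul_sum]
  rfl

theorem divergence_sum {ι : Type*} (t : Finset ι) {u : ι → Space d → Space d} {x : Space d}
    (hu : ∀ i, DifferentiableAt ℝ (u i) x) :
    divergence (fun y => ∑ i ∈ t, u i y) x = ∑ i ∈ t, divergence (u i) x := by
  simp only [divergence, fderiv_fun_sum fun i _ => hu i]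
  rw [Finset.sum_comm]
  refine Finset.sum_congr rfl fun i _ => ?_
  simp

theorem ExtendsContDiff.divergence {m : ℕ} {u : Space d → Space d} (hΩ : IsOpen Ω)
    (hu : ExtendsContDiff (m + 1) Ω u) : ExtendsContDiff m Ω (GePUP.divergence u) :=
  ExtendsContDiff.sum Finset.univ hΩ fun i =>
    (hu.fderiv_apply hΩ (EuclideanSpace.single i 1)).clm_comp hΩ (EuclideanSpace.proj (𝕜 := ℝ) i)

theorem ExtendsContDiff.laplacian {m : ℕ} {f : Space d → F} (hΩ : IsOpen Ω)
    (hf : ExtendsContDiff (m + 2) Ω f) :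
    ∃ g : Space d → F, ExtendsContDiff m Ω g ∧ EqOn g (Laplacian.laplacian f) Ω :=
  ⟨_, ExtendsContDiff.sum Finset.univ hΩ fun i =>
    ((hf.fderiv_apply (m := m + 1) hΩ (EuclideanSpace.single i 1)).fderiv_apply hΩ
      (EuclideanSpace.single i 1)),
    fun x hx => (laplacian_eq_sum ((hf.contDiffAt hΩ hx).of_le (by simp))).symm⟩

theorem ExtendsContDiff.hasContinuousExtension_gradient {f : Space d → ℝ} (hΩ : IsOpen Ω)
    (hf : ExtendsContDiff 1 Ω f) : HasContinuousExtension Ω (gradient f) :=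
  (hf.fderiv hΩ).hasContinuousExtension.comp
    (φ := fun L => (InnerProductSpace.toDual ℝ (Space d)).symm L)
    (InnerProductSpace.toDual ℝ (Space d)).symm.continuous

/-- The divergence commutes with the Laplacian on `C³` fields. -/
theorem divergence_laplacian (hΩ : IsOpen Ω) {w : Space d → Space d}
    (hw : ExtendsContDiff 3 Ω w) {x : Space d} (hx : x ∈ Ω) :
    divergence (Laplacian.laplacian w) x = Laplacian.laplacian (divergence w) x := by
  set e : Fin d → Space d := fun i => EuclideanSpace.single i 1 with he
  have h1 : ∀ i, ExtendsContDiff 2 Ω (fun y => fderiv ℝ w y (e i)) :=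
    fun i => hw.fderiv_apply hΩ (e i)
  have h2 : ∀ i j, ExtendsContDiff 1 Ω
      (fun y => fderiv ℝ (fun z => fderiv ℝ w z (e i)) y (e j)) :=
    fun i j => (h1 i).fderiv_apply hΩ (e j)
  have h2d : ∀ i j, DifferentiableAt ℝ
      (fun y => fderiv ℝ (fun z => fderiv ℝ w z (e i)) y (e j)) x :=
    fun i j => (h2 i j).differentiableAt hΩ hx
  have hL : Laplacian.laplacian w =ᶠ[𝓝 x]
      fun y => ∑ j, fderiv ℝ (fun z => fderiv ℝ w z (e j)) y (e j) := by
    filter_upwards [hΩ.mem_nhds hx] with y hy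
    exact laplacian_eq_sum ((hw.contDiffAt hΩ hy).of_le (by norm_num))
  -- the directional derivatives of the divergence near `x`
  have hD : ∀ j, (fun y => fderiv ℝ (divergence w) y (e j)) =ᶠ[𝓝 x]
      fun y => ∑ i, fderiv ℝ (fun z => fderiv ℝ w z (e i)) y (e j) i := by
    intro j
    filter_upwards [hΩ.mem_nhds hx] with y hy
    unfold divergence
    have hdi : ∀ i, DifferentiableAt ℝ (fun z => fderiv ℝ w z (e i)) y :=
      fun i => (h1 i).differentiableAt hΩ hy
    rw [fderiv_fun_sum fun i _ => by have := hdi i; simp only [he] at this; fun_prop]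
    rw [sum_apply]
    exact Finset.sum_congr rfl fun i _ => fderiv_coord (hdi i) i (e j)
  rw [laplacian_eq_sum (((hw.divergence hΩ).contDiffAt hΩ hx))]
  -- all third derivatives are now iterated directional derivatives, which commute
  have hrhs : ∀ j, fderiv ℝ (fun y => fderiv ℝ (divergence w) y (e j)) x (e j) =
      ∑ i, fderiv ℝ (fun y => fderiv ℝ (fun z => fderiv ℝ w z (e i)) y (e j)) x (e j) i := by
    intro j
    rw [(hD j).fderiv_eq, fderiv_fun_sum fun i _ => by have := h2d i j; fun_prop, sum_apply]
    exact Finset.sum_congr rfl fun i _ => fderiv_coord (h2d i j) i (e j)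
  have hlhs : divergence (Laplacian.laplacian w) x =
      ∑ i, ∑ j, fderiv ℝ (fun y => fderiv ℝ (fun z => fderiv ℝ w z (e j)) y (e j)) x (e i) i := by
    rw [divergence, hL.fderiv_eq, fderiv_fun_sum fun j _ => h2d j j]
    exact Finset.sum_congr rfl fun i _ => by simp [he]
  rw [hlhs, Finset.sum_comm]
  refine Finset.sum_congr rfl fun j _ => ?_
  refine Eq.trans ?_ (hrhs j).symm
  refine Finset.sum_congr rfl fun i _ => ?_
  rw [fderiv_fderiv_comm ((h1 j).contDiffAt hΩ hx)]
  have hc : (fun y => fderiv ℝ (fun z => fderiv ℝ w z (e j)) y (e i)) =ᶠ[𝓝 x]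
      fun y => fderiv ℝ (fun z => fderiv ℝ w z (e i)) y (e j) := by
    filter_upwards [hΩ.mem_nhds hx] with y hy
    exact fderiv_fderiv_comm ((hw.contDiffAt hΩ hy).of_le (by norm_num)) _ _
  rw [hc.fderiv_eq]

/-- Green's identity for a function that vanishes on the boundary. -/
theorem integral_mul_laplacian_eq_neg (hΩ : IsBoundedDomain Ω) {f : Space d → ℝ}
    (hf : ExtendsContDiff 2 Ω f) (hf0 : ∀ x ∈ frontier Ω, boundaryValue Ω f x = 0) :
    ∫ x in Ω, f x * Laplacian.laplacian f x = -∫ x in Ω, ‖gradient f x‖ ^ 2 := by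
  have h1 := fun i : Fin d => hf.fderiv_apply hΩ.isOpen (EuclideanSpace.single i 1)
  have h2 := fun i : Fin d => (h1 i).fderiv_apply hΩ.isOpen (EuclideanSpace.single i 1)
  have hL : ∫ x in Ω, f x * Laplacian.laplacian f x = ∫ x in Ω, ∑ i : Fin d,
      f x * fderiv ℝ (fun y => fderiv ℝ f y (EuclideanSpace.single i 1)) x
        (EuclideanSpace.single i 1) := by
    refine setIntegral_congr_fun hΩ.isOpen.measurableSet fun x hx => ?_
    simp only [laplacian_eq_sum (hf.contDiffAt hΩ.isOpen hx), Finset.mul_sum]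
  rw [hL, integral_finsetSum _ fun i _ =>
    (hf.hasContinuousExtension.mul (h2 i).hasContinuousExtension).integrableOn hΩ]
  simp only [norm_gradient_sq]
  simp only [pow_two]
  rw [integral_finsetSum _ fun i _ =>
    ((h1 i).hasContinuousExtension.mul (h1 i).hasContinuousExtension).integrableOn hΩ,
    ← Finset.sum_neg_distrib]
  exact Finset.sum_congr rfl fun i _ =>
    integral_mul_fderiv_eq_neg hΩ _ hf.of_succ (h1 i) hf0

theorem l2Norm_sq {F : Type*} [NormedAddCommGroup F] [InnerProductSpace ℝ F] (f : Space d → F) :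
    l2Norm Ω f ^ 2 = ∫ x in Ω, ‖f x‖ ^ 2 := by
  rw [l2Norm, l2Inner, Real.sq_sqrt (integral_nonneg fun x => real_inner_self_nonneg)]
  simp only [real_inner_self_eq_norm_sq]

end Operators

/-! ### The slopes of a step -/

section Step

variable {d s : ℕ} {P : Problem d} {R : RKMethod s} {T : Trajectory d s} {n : ℕ}

namespace IsStep

theorem differentiableAt_stageExplicit (hΩ : IsOpen P.Ω) (h : IsStep P R T n) (i : Fin s)
    {x : Space d} (hx : x ∈ P.Ω) : DifferentiableAt ℝ (stageExplicit P R T n i) x := by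
  have h1 := (h.force_reg i).extends.differentiableAt hΩ hx
  have h2 := (h.uT_reg i).extends.differentiableAt hΩ hx
  have h3 := ((h.uT_reg i).extends.fderiv hΩ).differentiableAt hΩ hx
  have h4 : DifferentiableAt ℝ (convection (T.uT n i) (T.uT n i)) x := h3.clm_apply h2
  exact h1.sub (h4.fun_const_smul _)

theorem differentiableAt_laplacian (hΩ : IsOpen P.Ω) (h : IsStep P R T n) (i : Fin s)
    {x : Space d} (hx : x ∈ P.Ω) : DifferentiableAt ℝ (Laplacian.laplacian (T.wS n i)) x := by
  obtain ⟨g, hg, hgL⟩ := (h.wS_reg i).extends.laplacian (m := 1) hΩ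
  exact (hg.differentiableAt hΩ hx).congr_of_eventuallyEq
    (hgL.symm.eventuallyEq_of_mem (hΩ.mem_nhds hx))

theorem contDiffAt_q (hΩ : IsOpen P.Ω) (h : IsStep P R T n) (i : Fin s)
    {x : Space d} (hx : x ∈ P.Ω) : ContDiffAt ℝ 2 (T.qS n i) x :=
  (h.qS_reg i).extends.contDiffAt hΩ hx

theorem differentiableAt_stageSlope (hΩ : IsOpen P.Ω) (h : IsStep P R T n) (i : Fin s)
    {x : Space d} (hx : x ∈ P.Ω) : DifferentiableAt ℝ (stageSlope P R T n i) x :=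
  ((h.differentiableAt_stageExplicit hΩ i hx).sub
    (differentiableAt_gradient (h.contDiffAt_q hΩ i hx))).add
    ((h.differentiableAt_laplacian hΩ i hx).fun_const_smul _)

/-- The pressure equation removes the explicit terms from the divergence of a slope, so that the
divergence of `w` obeys a heat equation. -/
theorem divergence_stageSlope (hΩ : IsOpen P.Ω) (h : IsStep P R T n) (i : Fin s)
    {x : Space d} (hx : x ∈ P.Ω) :
    divergence (stageSlope P R T n i) x =
      P.ν * Laplacian.laplacian (divergence (T.wS n i)) x := by
  have h1 := h.differentiableAt_stageExplicit hΩ i hx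
  have h2 := differentiableAt_gradient (h.contDiffAt_q hΩ i hx)
  have h3 := h.differentiableAt_laplacian hΩ i hx
  have h4 : stageSlope P R T n i = fun y => (stageExplicit P R T n i y
      + (-1 : ℝ) • gradient (T.qS n i) y) + P.ν • Laplacian.laplacian (T.wS n i) y := by
    funext y
    simp [stageSlope, sub_eq_add_neg]
  rw [h4, divergence_add (h1.fun_add (h2.fun_const_smul _)) (h3.fun_const_smul _),
    divergence_add h1 (h2.fun_const_smul _), divergence_const_smul _ h2, divergence_const_smul _ h3,
    divergence_gradient (h.contDiffAt_q hΩ i hx), h.laplacian_q i x hx,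
    divergence_laplacian hΩ (h.wS_reg i).extends hx]
  ring

theorem ext_stageExplicit_add (hΩ : IsOpen P.Ω) (h : IsStep P R T n) (i : Fin s) :
    HasContinuousExtension P.Ω fun y => stageExplicit P R T n i y
        + P.ν • Laplacian.laplacian (T.wS n i) y := by
  have h1 := (h.force_reg i).extends.hasContinuousExtension
  have h2 := (h.uT_reg i).extends.hasContinuousExtension
  have h3 := ((h.uT_reg i).extends.fderiv hΩ).hasContinuousExtension
  have h4 : HasContinuousExtension P.Ω (convection (T.uT n i) (T.uT n i)) :=
    h3.comp₂ (φ := fun p : (Space d →L[ℝ] Space d) × Space d => p.1 p.2) (by fun_prop) h2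
  obtain ⟨g, hg, hgL⟩ := (h.wS_reg i).extends.laplacian (m := 1) hΩ
  exact (h1.sub (h4.const_smul _)).add ((hg.hasContinuousExtension.congr hgL).const_smul _)

theorem ext_gradient_q (hΩ : IsOpen P.Ω) (h : IsStep P R T n) (i : Fin s) :
    HasContinuousExtension P.Ω (gradient (T.qS n i)) :=
  (h.qS_reg i).extends.of_succ.hasContinuousExtension_gradient hΩ

/-- The Neumann condition for the pressure turns the normal component of a slope on the boundary
into the damping term `-λ n ⬝ w`. -/
theorem exists_tendsto_stageSlope (hΩ : IsOpen P.Ω) (h : IsStep P R T n) (i : Fin s)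
    {x e : Space d} (he : IsOutwardUnitNormal P.Ω x e) :
    ∃ ρ : Space d, Tendsto (stageSlope P R T n i) (𝓝[P.Ω] x) (𝓝 ρ) ∧
      inner ℝ e ρ = -P.lam * inner ℝ e (T.wS n i x) := by
  have hx : x ∈ closure P.Ω := frontier_subset_closure he.1
  have h1 := (h.ext_stageExplicit_add hΩ i).tendsto_boundaryValue hx
  have h2 := (h.ext_gradient_q hΩ i).tendsto_boundaryValue hx
  refine ⟨_, (h1.sub h2).congr fun y => ?_, ?_⟩
  · rw [stageSlope]; abel
  · rw [inner_sub_right, h.normal_q i x e he]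
    ring

end IsStep

/-- Passing to the boundary in an update `f = w + k ∑ c_j ρ_j` of the normal component. -/
theorem IsStep.inner_normal_update (hΩ : IsOpen P.Ω) (h : IsStep P R T n) (c : Fin s → ℝ)
    {f : Space d → Space d} (hf : ContinuousOn f (closure P.Ω))
    (hfw : ∀ x ∈ P.Ω, f x = T.w n x + P.k • ∑ j, c j • stageSlope P R T n j x)
    {x e : Space d} (he : IsOutwardUnitNormal P.Ω x e) :
    (inner ℝ e (f x) : ℝ) = inner ℝ e (T.w n x)
      + P.k * ∑ j, c j * (-P.lam * inner ℝ e (T.wS n j x)) := by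
  have hx : x ∈ closure P.Ω := frontier_subset_closure he.1
  have : (𝓝[P.Ω] x).NeBot := mem_closure_iff_nhdsWithin_neBot.1 hx
  choose ρ hρ hρe using fun j => h.exists_tendsto_stageSlope hΩ j he
  have h1 : Tendsto f (𝓝[P.Ω] x) (𝓝 (f x)) :=
    (hf x hx).mono_left (nhdsWithin_mono x subset_closure)
  have h2 : Tendsto (T.w n) (𝓝[P.Ω] x) (𝓝 (T.w n x)) :=
    (h.w_reg.1 x hx).mono_left (nhdsWithin_mono x subset_closure)
  have h3 : Tendsto f (𝓝[P.Ω] x) (𝓝 (T.w n x + P.k • ∑ j, c j • ρ j)) := by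
    refine (h2.add ((tendsto_finsetSum Finset.univ fun j _ =>
      (hρ j).const_smul (c j)).const_smul P.k)).congr' ?_
    filter_upwards [self_mem_nhdsWithin] with y hy
    exact (hfw y hy).symm
  rw [tendsto_nhds_unique h1 h3, inner_add_right, inner_smul_right, inner_sum]
  simp only [inner_smul_right, hρe]

/-- The divergence of an update `f = w + k ∑ c_j ρ_j`. -/
theorem IsStep.divergence_update (hΩ : IsOpen P.Ω) (h : IsStep P R T n) (c : Fin s → ℝ)
    {f : Space d → Space d}
    (hfw : ∀ x ∈ P.Ω, f x = T.w n x + P.k • ∑ j, c j • stageSlope P R T n j x)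
    {x : Space d} (hx : x ∈ P.Ω) :
    divergence f x = divergence (T.w n) x
      + P.k * ∑ j, c j * (P.ν * Laplacian.laplacian (divergence (T.wS n j)) x) := by
  have h1 : f =ᶠ[𝓝 x] fun y => T.w n y + P.k • ∑ j, c j • stageSlope P R T n j y := by
    filter_upwards [hΩ.mem_nhds hx] with y hy using hfw y hy
  have h2 := h.w_reg.extends.differentiableAt hΩ hx
  have h3 := fun j => h.differentiableAt_stageSlope hΩ j hx
  have h4 : DifferentiableAt ℝ (fun y => ∑ j, c j • stageSlope P R T n j y) x := by fun_prop
  have h5 : divergence f x =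
      divergence (fun y => T.w n y + P.k • ∑ j, c j • stageSlope P R T n j y) x := by
    rw [divergence, h1.fderiv_eq]
    rfl
  rw [h5, divergence_add h2 (h4.fun_const_smul _), divergence_const_smul _ h4,
    divergence_sum _ fun j => (h3 j).fun_const_smul (c j)]
  simp only [divergence_const_smul _ (h3 _), h.divergence_stageSlope hΩ _ hx]

/-! ### The two energy inequalities -/

theorem IsStep.l2Norm_divergence_sq_sub_le (hP : P.Admissible) (hR : R.AlgebraicallyStable)
    (h : IsStep P R T n) :
    l2Norm P.Ω (divergence (T.w (n + 1))) ^ 2 - l2Norm P.Ω (divergence (T.w n)) ^ 2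
      ≤ -2 * P.k * P.ν * ∑ i, R.b i * l2Norm P.Ω (gradient (divergence (T.wS n i))) ^ 2 := by
  have hΩ := hP.isDomain.isOpen
  have hD : ∀ i, ExtendsContDiff 2 P.Ω (divergence (T.wS n i)) :=
    fun i => (h.wS_reg i).extends.divergence hΩ
  have hint : ∀ {w : Space d → Space d}, ContDiffUpToBoundary 1 P.Ω w →
      IntegrableOn (fun x => ‖divergence w x‖ ^ 2) P.Ω := by
    intro w hw
    exact ((hw.extends.divergence hΩ).hasContinuousExtension.comp
      (φ := fun t => ‖t‖ ^ 2) (by fun_prop)).integrableOn hP.isDomain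
  have hintL : ∀ i, IntegrableOn (fun x => divergence (T.wS n i) x
      * Laplacian.laplacian (divergence (T.wS n i)) x) P.Ω := by
    intro i
    obtain ⟨g, hg, hgL⟩ := (hD i).laplacian (m := 0) hΩ
    exact ((hD i).hasContinuousExtension.mul
      (hg.hasContinuousExtension.congr hgL)).integrableOn hP.isDomain
  have hpt : ∀ x ∈ P.Ω, ‖divergence (T.w (n + 1)) x‖ ^ 2 - ‖divergence (T.w n) x‖ ^ 2 ≤
      ∑ i, 2 * P.k * P.ν * R.b i * (divergence (T.wS n i) x
        * Laplacian.laplacian (divergence (T.wS n i)) x) := by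
    intro x hx
    have := hR.sq_sub_sq_le P.k _ _ (fun i => divergence (T.wS n i) x)
      (fun i => P.ν * Laplacian.laplacian (divergence (T.wS n i)) x)
      (fun i => h.divergence_update hΩ _ (h.stage_w i) hx)
      (h.divergence_update hΩ _ h.w_succ hx)
    simp only [Real.norm_eq_abs, sq_abs]
    refine this.trans_eq ?_
    rw [Finset.mul_sum]
    exact Finset.sum_congr rfl fun i _ => by ring
  simp only [l2Norm_sq]
  rw [← integral_sub (hint h.w_succ_reg) (hint h.w_reg)]
  refine (setIntegral_mono_on ((hint h.w_succ_reg).sub (hint h.w_reg))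
    (integrable_finsetSum _ fun i _ => (hintL i).const_mul _) hΩ.measurableSet hpt).trans_eq ?_
  rw [integral_finsetSum _ fun i _ => (hintL i).const_mul _, Finset.mul_sum]
  refine Finset.sum_congr rfl fun i _ => ?_
  rw [integral_const_mul, integral_mul_laplacian_eq_neg hP.isDomain (hD i) (h.divergence_w i)]
  ring

theorem IsStep.normal_sq_sub_le (hΩ : IsOpen P.Ω) (hR : R.AlgebraicallyStable)
    (h : IsStep P R T n) {x e : Space d} (he : IsOutwardUnitNormal P.Ω x e) :
    |(inner ℝ e (T.w (n + 1) x) : ℝ)| ^ 2 - |(inner ℝ e (T.w n x) : ℝ)| ^ 2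
      ≤ -2 * P.k * P.lam * ∑ i, R.b i * |(inner ℝ e (T.wS n i x) : ℝ)| ^ 2 := by
  have := hR.sq_sub_sq_le P.k _ _ (fun i => (inner ℝ e (T.wS n i x) : ℝ))
    (fun i => -P.lam * inner ℝ e (T.wS n i x))
    (fun i => h.inner_normal_update hΩ _ (h.wS_reg i).1 (h.stage_w i) he)
    (h.inner_normal_update hΩ _ h.w_succ_reg.1 h.w_succ he)
  simp only [sq_abs]
  refine this.trans_eq ?_
  rw [Finset.mul_sum, Finset.mul_sum]
  exact Finset.sum_congr rfl fun i _ => by ring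

end Step

end GePUP

theorem mainTheorem2 {d s : ℕ} (P : GePUP.Problem d) (hP : P.Admissible)
    (R : GePUP.RKMethod s) (hR : R.AlgebraicallyStable)
    (N : ℕ∞) (T : GePUP.Trajectory d s) (hT : GePUP.IsGePUPESRK P R N T)
    (hinit : ∀ x ∈ frontier P.Ω, T.w 0 x = T.u 0 x) :
    (∀ n : ℕ, (n : ℕ∞) < N →
      GePUP.l2Norm P.Ω (GePUP.divergence (T.w (n + 1))) ^ 2
          - GePUP.l2Norm P.Ω (GePUP.divergence (T.w n)) ^ 2
        ≤ -2 * P.k * P.ν * ∑ i : Fin s,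
            R.b i * GePUP.l2Norm P.Ω (gradient (GePUP.divergence (T.wS n i))) ^ 2) ∧
    (∀ n : ℕ, (n : ℕ∞) < N →
      ∀ x e : GePUP.Space d, GePUP.IsOutwardUnitNormal P.Ω x e →
        |inner ℝ e (T.w (n + 1) x)| ^ 2 - |inner ℝ e (T.w n x)| ^ 2
          ≤ -2 * P.k * P.lam * ∑ i : Fin s, R.b i * |inner ℝ e (T.wS n i x)| ^ 2) := by
  refine ⟨fun n hn => (hT n hn).l2Norm_divergence_sq_sub_le hP hR, fun n hn x e he => ?_⟩
  exact (hT n hn).normal_sq_sub_le hP.isDomain.isOpen hR he
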